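/- Let $T, L, \ell \ge 1$ be integers (number of time periods, minimum-up time and minimum-down time), with $L \le T-1$ and $\ell \le T-1$ if $T \ge 2$. Let $\underline C, \overline C, \overline V, V$ be real numbers (lower and upper generation bounds, start-up/shut-down ramp rate, and ramp-up/ -down rate) with $\underline C \ge 0$, $\underline C < \overline V < \underline C + V$ and $V = \overline C - \underline C$. For integers $a,b$ write $[a,b]_{\mathbb Z}$ for the set of integers $i$ with $a \le i \le b$ (empty if $a>b$). Let $P$ be the set of all $(x,y,u) \in \mathbb R_+^T \times \{0,1\}^T \times \{0,1\}^{T-1}$, where $x=(x_1,\dots,x_T)$, $y=(y_1,\dots,y_T)$, $u=(u_2,\dots,u_T)$, such that \begin{align*} &\textstyle\sum_{i=t-L+1}^{t} u_i \le y_t, && t \in [L+1,T]_{\mathbb Z},\\ &\textstyle\sum_{i=t-\ell+1}^{t} u_i \le 1-y_{t-\ell}, && t \in [\ell+1,T]_{\mathbb Z},\\ &y_t-y_{t-1}-u_t \le 0, && t \in [2,T]_{\mathbb Z},\\ &-x_t+\underline C\, y_t \le 0, \qquad x_t-\overline C\, y_t \le 0, && t \in [1,T]_{\mathbb Z},\\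 &x_t-x_{t-1} \le V y_{t-1}+\overline V(1-y_{t-1}), && t \in [2,T]_{\mathbb Z},\\ &x_{t-1}-x_t \le V y_t+\overline V(1-y_t), && t \in [2,T]_{\mathbb Z}. \end{align*} Then for every $t \in [1,T]_{\mathbb Z}$, with $s=\min\{t+1,T\}$ and $j=\min\{1,\,L-1,\,s-2,\,s-t\}$ (the sum below being empty if $j=-1$), the inequality $$x_t \le \overline V y_t + (\overline C-\overline V)\Bigl(y_s-\sum_{i=0}^{j} u_{s-i}\Bigr)$$ is valid for $\operatorname{conv}(P)$ (every point of $\operatorname{conv}(P)$ satisfies it) and facet-defining for $\operatorname{conv}(P)$ (the set of points of $\operatorname{conv}(P)$ at which it holds with equality is nonempty and has affine dimension $\dim \operatorname{conv}(P) - 1$). -/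

import Mathlib

/-- The value at time `t` of a vector indexed by the integers in `[a, b]`. It is only evaluated at
times `t ∈ [a, b]`; outside that range the value is an irrelevant `0`. -/
noncomputable def valAt {a b : ℤ} (f : Finset.Icc a b → ℝ) (t : ℤ) : ℝ :=
  if h : t ∈ Finset.Icc a b then f ⟨t, h⟩ else 0

/-- The space `ℝ^T × ℝ^T × ℝ^(T-1)` of triples `(x, y, u)`, where `x` and `y` are indexed by the
times `1, …, T` and `u` is indexed by the times `2, …, T`. -/
abbrev UCPoint (T : ℤ) : Type :=
  (Finset.Icc (1 : ℤ) T → ℝ) × (Finset.Icc (1 : ℤ) T → ℝ) × (Finset.Icc (2 : ℤ) T → ℝ)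

namespace UCPoint

/-- Generation amount at time `t ∈ [1, T]`. -/
noncomputable def x {T : ℤ} (p : UCPoint T) (t : ℤ) : ℝ := valAt p.1 t

/-- Online status at time `t ∈ [1, T]`. -/
noncomputable def y {T : ℤ} (p : UCPoint T) (t : ℤ) : ℝ := valAt p.2.1 t

/-- Start-up decision at time `t ∈ [2, T]`. -/
noncomputable def u {T : ℤ} (p : UCPoint T) (t : ℤ) : ℝ := valAt p.2.2 t

end UCPoint

/-- The set `P` of feasible schedules: horizon `T`, minimum-up time `L`, minimum-down time `l`,
generation bounds `Clo` and `Cup`, start-up/shut-down ramp rate `Vbar`, ramp rate `V`. -/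
structure IsFeasible (T L l : ℤ) (Clo Cup Vbar V : ℝ) (p : UCPoint T) : Prop where
  x_nonneg : ∀ t ∈ Finset.Icc 1 T, 0 ≤ p.x t
  y_binary : ∀ t ∈ Finset.Icc 1 T, p.y t = 0 ∨ p.y t = 1
  u_binary : ∀ t ∈ Finset.Icc 2 T, p.u t = 0 ∨ p.u t = 1
  min_up : ∀ t ∈ Finset.Icc (L + 1) T, ∑ i ∈ Finset.Icc (t - L + 1) t, p.u i ≤ p.y t
  min_down : ∀ t ∈ Finset.Icc (l + 1) T,
    ∑ i ∈ Finset.Icc (t - l + 1) t, p.u i ≤ 1 - p.y (t - l)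
  start_up : ∀ t ∈ Finset.Icc 2 T, p.y t - p.y (t - 1) - p.u t ≤ 0
  lower_bound : ∀ t ∈ Finset.Icc 1 T, -p.x t + Clo * p.y t ≤ 0
  upper_bound : ∀ t ∈ Finset.Icc 1 T, p.x t - Cup * p.y t ≤ 0
  ramp_up : ∀ t ∈ Finset.Icc 2 T,
    p.x t - p.x (t - 1) ≤ V * p.y (t - 1) + Vbar * (1 - p.y (t - 1))
  ramp_down : ∀ t ∈ Finset.Icc 2 T,
    p.x (t - 1) - p.x t ≤ V * p.y t + Vbar * (1 - p.y t)

/-- The set `P` as a subset of `ℝ^T × ℝ^T × ℝ^(T-1)`. -/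
def feasibleSet (T L l : ℤ) (Clo Cup Vbar V : ℝ) : Set (UCPoint T) :=
  {p | IsFeasible T L l Clo Cup Vbar V p}

/-- The inequality `lhs ≤ rhs` is valid for `K`: every point of `K` satisfies it. -/
def IsValidIneq {E : Type*} (K : Set E) (lhs rhs : E → ℝ) : Prop :=
  ∀ p ∈ K, lhs p ≤ rhs p

/-- The dimension of (the affine hull of) a nonempty set. -/
noncomputable def affineDim {E : Type*} [AddCommGroup E] [Module ℝ E] (K : Set E) : ℕ :=
  Module.finrank ℝ (vectorSpan ℝ K)

/-- The linear inequality `lhs ≤ rhs` is facet-defining for the convex set `K`: it is valid for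
`K`, and the face of `K` on which it holds with equality is nonempty and of dimension
`dim K - 1`. -/
def IsFacetDefining {E : Type*} [AddCommGroup E] [Module ℝ E] (K : Set E)
    (lhs rhs : E → ℝ) : Prop :=
  IsValidIneq K lhs rhs ∧ {p ∈ K | lhs p = rhs p}.Nonempty ∧
    affineDim {p ∈ K | lhs p = rhs p} + 1 = affineDim K

/-- The index `s = min {t + 1, T}`. -/
def idxS (T t : ℤ) : ℤ := min (t + 1) T

/-- The index `j = min {1, L - 1, s - 2, s - t}` with `s = min {t + 1, T}`; it may be `-1`, and
then the sum over `i = 0, …, j` is empty. -/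
def idxJ (T L t : ℤ) : ℤ :=
  min 1 (min (L - 1) (min (idxS T t - 2) (idxS T t - t)))

/-! Validity: the slack is linear, so it suffices to bound it on P. By minimum down- and up-time, a
start-up at i forces y = 0 at i - 1 and y = 1 on [i, i + L - 1] within the horizon. Hence the
bracket multiplying `Cup - Vbar` is never negative, and when it is 0 with the unit online, a ramp
constraint gives x_t ≤ `Vbar`.

Facet: schedules online on a single interval, with x_t chosen to give equality, lie on the face, and
so does 0. Their differences, together with the one direction `unitX` t, span the whole space
(`Submodule.eq_top_of_interval_mem`). The slack vanishes on the face but not on `unitX` t, so the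
face has codimension one (`affineDim_add_one_of_sup_span_eq_top`). -/

namespace UCPoint

variable {T : ℤ}

@[simp] lemma x_add (p q : UCPoint T) (t : ℤ) : x (p + q) t = x p t + x q t := by
  unfold x valAt; split_ifs <;> simp

@[simp] lemma y_add (p q : UCPoint T) (t : ℤ) : y (p + q) t = y p t + y q t := by
  unfold y valAt; split_ifs <;> simp

@[simp] lemma u_add (p q : UCPoint T) (t : ℤ) : u (p + q) t = u p t + u q t := by
  unfold u valAt; split_ifs <;> simp

@[simp] lemma x_smul (c : ℝ) (p : UCPoint T) (t : ℤ) : x (c • p) t = c * x p t := by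
  unfold x valAt; split_ifs <;> simp

@[simp] lemma y_smul (c : ℝ) (p : UCPoint T) (t : ℤ) : y (c • p) t = c * y p t := by
  unfold y valAt; split_ifs <;> simp

@[simp] lemma u_smul (c : ℝ) (p : UCPoint T) (t : ℤ) : u (c • p) t = c * u p t := by
  unfold u valAt; split_ifs <;> simp

/-- The slack `lhs - rhs` of the inequality, as a linear functional. -/
noncomputable def slack (T L : ℤ) (Cup Vbar : ℝ) (t : ℤ) : UCPoint T →ₗ[ℝ] ℝ where
  toFun p := x p t - (Vbar * y p t + (Cup - Vbar) *
    (y p (idxS T t) - ∑ i ∈ Finset.Icc 0 (idxJ T L t), u p (idxS T t - i)))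
  map_add' p q := by
    simp only [x_add, y_add, u_add, Finset.sum_add_distrib]; ring
  map_smul' c p := by
    simp only [x_smul, y_smul, u_smul, ← Finset.mul_sum, RingHom.id_apply, smul_eq_mul]; ring

/-- The schedule that is online exactly on `[a, b]`, with generation amounts `f`. -/
noncomputable def interval (T a b : ℤ) (f : ℤ → ℝ) : UCPoint T :=
  (fun i => if a ≤ i.1 ∧ i.1 ≤ b then f i.1 else 0,
    fun i => if a ≤ i.1 ∧ i.1 ≤ b then 1 else 0, fun i => if i.1 = a then 1 else 0)

lemma interval_x {a b t : ℤ} (f : ℤ → ℝ) (h1 : 1 ≤ t) (hT : t ≤ T) :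
    x (interval T a b f) t = if a ≤ t ∧ t ≤ b then f t else 0 := by
  simp [x, valAt, interval, h1, hT]

lemma interval_y {a b t : ℤ} (f : ℤ → ℝ) (h1 : 1 ≤ t) (hT : t ≤ T) :
    y (interval T a b f) t = if a ≤ t ∧ t ≤ b then 1 else 0 := by
  simp [y, valAt, interval, h1, hT]

lemma interval_u {a b t : ℤ} (f : ℤ → ℝ) (h1 : 2 ≤ t) (hT : t ≤ T) :
    u (interval T a b f) t = if t = a then 1 else 0 := by
  simp [u, valAt, interval, h1, hT]

lemma sum_interval_u {a b c d : ℤ} (f : ℤ → ℝ) (h1 : 2 ≤ c) (hT : d ≤ T) :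
    ∑ i ∈ Finset.Icc c d, u (interval T a b f) i = if c ≤ a ∧ a ≤ d then 1 else 0 := by
  rw [Finset.sum_congr rfl fun i hi => interval_u f (h1.trans (Finset.mem_Icc.1 hi).1)
    ((Finset.mem_Icc.1 hi).2.trans hT)]
  simp

/-- The unit vector of the generation amount at time `r`. -/
noncomputable def unitX (r : Finset.Icc (1 : ℤ) T) : UCPoint T := (Pi.single r 1, 0, 0)

lemma interval_sub_interval {r : ℤ} (hr : r ∈ Finset.Icc 1 T) (f g : ℤ → ℝ)
    (h : ∀ i, i ≠ r → f i = g i) :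
    interval T 1 T f - interval T 1 T g = (f r - g r) • unitX ⟨r, hr⟩ := by
  refine Prod.ext (funext fun i => ?_)
    (Prod.ext (by simp [interval, unitX]) (by simp [interval, unitX]))
  have hi := Finset.mem_Icc.1 i.2
  by_cases hir : i = ⟨r, hr⟩
  · subst hir; simp [interval, unitX, hi]
  · have : i.1 ≠ r := fun hh => hir (Subtype.ext hh)
    simp [interval, unitX, hi, hir, h _ this]

end UCPoint

/-! ### Spanning and dimension count -/

open UCPoint

lemma Submodule.eq_top_of_forall_single_mem {ι : Type*} [Fintype ι] [DecidableEq ι]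
    (N : Submodule ℝ (ι → ℝ)) (h : ∀ i, Pi.single i 1 ∈ N) : N = ⊤ := by
  refine eq_top_iff.2 fun f _ => ?_
  rw [pi_eq_sum_univ' f]
  refine N.sum_mem fun i _ => N.smul_mem _ ?_
  convert h i using 1

/-- Triangular elimination: x-parts can be discarded first. A start at time 1 has no u-entry, so
consecutive prefixes [1, b] differ by a y unit vector. A start at a ≥ 2 then leaves exactly the u
unit vector at a. -/
lemma Submodule.eq_top_of_interval_mem {T : ℤ} (W : Submodule ℝ (UCPoint T))
    (hx : ∀ r, unitX r ∈ W) (hy : ∀ b, 1 ≤ b → b ≤ T → ∃ f, interval T 1 b f ∈ W)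
    (hu : ∀ a, 2 ≤ a → a ≤ T → ∃ b f, interval T a b f ∈ W) : W = ⊤ := by
  have hX : ∀ f, ((f, 0, 0) : UCPoint T) ∈ W := fun f => by
    have := Submodule.eq_top_of_forall_single_mem
      (W.comap (LinearMap.inl ℝ _ _)) (fun i => hx i)
    exact (this ▸ Submodule.mem_top : f ∈ W.comap (LinearMap.inl ℝ _ _))
  -- The empty prefix b = 0 makes the unit vector at time 1 a difference of prefixes too.
  have hstep : ∀ b, 0 ≤ b → b ≤ T →
      ((0, fun i => if i.1 ≤ b then 1 else 0, 0) : UCPoint T) ∈ W := by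
    intro b hb0 hbT
    rcases hb0.eq_or_lt with rfl | hb
    · convert W.zero_mem using 1
      change _ = ((0, 0, 0) : UCPoint T)
      refine Prod.ext rfl (Prod.ext (funext fun i => ?_) rfl)
      exact if_neg (by have := Finset.mem_Icc.1 i.2; omega)
    · obtain ⟨f, hf⟩ := hy b hb hbT
      convert W.sub_mem hf (hX (interval T 1 b f).1) using 1
      refine Prod.ext (by simp) (Prod.ext (funext fun i => ?_) (funext fun i => ?_))
      · have := Finset.mem_Icc.1 i.2
        simp [interval, this]
      · have := Finset.mem_Icc.1 i.2
        have h1 : i.1 ≠ 1 := by omega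
        simp [interval, h1]
  have hY : ∀ f, ((0, f, 0) : UCPoint T) ∈ W := fun f => by
    have := Submodule.eq_top_of_forall_single_mem
      (W.comap ((LinearMap.inr ℝ _ _).comp (LinearMap.inl ℝ _ _))) (fun i => by
        have hi := Finset.mem_Icc.1 i.2
        show ((0, Pi.single i 1, 0) : UCPoint T) ∈ W
        convert W.sub_mem (hstep i (by omega) hi.2) (hstep (i - 1) (by omega) (by omega)) using 1
        refine Prod.ext (by simp) (Prod.ext (funext fun k => ?_) (by simp))
        by_cases hk : k = i
        · subst hk; simp
        · have : k ≤ i ↔ k < i := ⟨fun h => lt_of_le_of_ne h hk, le_of_lt⟩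
          simp [hk, this])
    exact (this ▸ Submodule.mem_top :
      f ∈ W.comap ((LinearMap.inr ℝ _ _).comp (LinearMap.inl ℝ _ _)))
  have hU : ∀ f, ((0, 0, f) : UCPoint T) ∈ W := fun f => by
    have := Submodule.eq_top_of_forall_single_mem
      (W.comap ((LinearMap.inr ℝ _ _).comp (LinearMap.inr ℝ _ _))) (fun i => by
        have hi := Finset.mem_Icc.1 i.2
        show ((0, 0, Pi.single i 1) : UCPoint T) ∈ W
        obtain ⟨b, f, hf⟩ := hu i hi.1 hi.2
        convert W.sub_mem (W.sub_mem hf (hX (interval T i b f).1))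
          (hY (interval T i b f).2.1) using 1
        refine Prod.ext (by simp) (Prod.ext (by simp) (funext fun k => ?_))
        simp [interval, Pi.single_apply])
    exact (this ▸ Submodule.mem_top :
      f ∈ W.comap ((LinearMap.inr ℝ _ _).comp (LinearMap.inr ℝ _ _)))
  refine eq_top_iff.2 fun p _ => ?_
  have := W.add_mem (W.add_mem (hX p.1) (hY p.2.1)) (hU p.2.2)
  convert this using 1
  simp

/-- Since φ kills the directions of F but not v, the line through v is a complement of them; as v is
a direction of K, K is full-dimensional. -/
lemma affineDim_add_one_of_sup_span_eq_top {E : Type*} [AddCommGroup E] [Module ℝ E]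
    [FiniteDimensional ℝ E] {F K : Set E} (φ : E →ₗ[ℝ] ℝ) (v : E) (hφ : ∀ p ∈ F, φ p = 0)
    (hv : φ v ≠ 0) (hFK : F ⊆ K) (hvK : v ∈ vectorSpan ℝ K)
    (htop : vectorSpan ℝ F ⊔ Submodule.span ℝ {v} = ⊤) : affineDim F + 1 = affineDim K := by
  have hv0 : v ≠ 0 := fun h => hv (by simp [h])
  have hker : vectorSpan ℝ F ≤ LinearMap.ker φ := by
    refine Submodule.span_le.2 ?_
    rintro _ ⟨p, hp, q, hq, rfl⟩
    simp [hφ p hp, hφ q hq]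
  have hcompl : IsCompl (vectorSpan ℝ F) (Submodule.span ℝ {v}) := by
    refine ⟨(Submodule.disjoint_span_singleton' hv0).2 fun h => hv (hker h),
      codisjoint_iff.2 htop⟩
  have hK : vectorSpan ℝ K = ⊤ := by
    refine eq_top_iff.2 (htop ▸ sup_le (vectorSpan_mono ℝ hFK) ?_)
    simpa using hvK
  have := Submodule.finrank_add_eq_of_isCompl hcompl
  rw [finrank_span_singleton hv0] at this
  rw [affineDim, affineDim, hK, this, finrank_top]

/-- For t < T, the term u_t enters only if t ≥ 2 and L ≥ 2, which is when a start at t guarantees y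
= 1 at t + 1. -/
lemma idx_cases {T L t : ℤ} (hL : 1 ≤ L) (ht1 : 1 ≤ t) (htT : t ≤ T) (f : ℤ → ℝ) :
    (t = T ∧ T = 1 ∧ idxS T t = t ∧ ∑ i ∈ Finset.Icc 0 (idxJ T L t), f (idxS T t - i) = 0) ∨
    (t = T ∧ 2 ≤ T ∧ idxS T t = t ∧
      ∑ i ∈ Finset.Icc 0 (idxJ T L t), f (idxS T t - i) = f t) ∨
    (t < T ∧ (L = 1 ∨ t = 1) ∧ idxS T t = t + 1 ∧
      ∑ i ∈ Finset.Icc 0 (idxJ T L t), f (idxS T t - i) = f (t + 1)) ∨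
    (t < T ∧ 2 ≤ L ∧ 2 ≤ t ∧ idxS T t = t + 1 ∧
      ∑ i ∈ Finset.Icc 0 (idxJ T L t), f (idxS T t - i) = f (t + 1) + f t) := by
  rcases htT.eq_or_lt with h | h
  · have hs : idxS T t = t := by unfold idxS; omega
    rcases (show T = 1 ∨ 2 ≤ T by omega) with h1 | h1
    · have hj : idxJ T L t = -1 := by unfold idxJ; omega
      exact Or.inl ⟨h, h1, hs, by rw [hj]; simp⟩
    · have hj : idxJ T L t = 0 := by unfold idxJ; omega
      exact Or.inr (Or.inl ⟨h, h1, hs, by rw [hj, hs]; simp⟩)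
  · have hs : idxS T t = t + 1 := by unfold idxS; omega
    by_cases h1 : L = 1 ∨ t = 1
    · have hj : idxJ T L t = 0 := by unfold idxJ; omega
      exact Or.inr (Or.inr (Or.inl ⟨h, h1, hs, by rw [hj, hs]; simp⟩))
    · have hj : idxJ T L t = 1 := by unfold idxJ; omega
      have hI : Finset.Icc (0 : ℤ) 1 = {0, 1} := rfl
      exact Or.inr (Or.inr (Or.inr ⟨h, by omega, by omega, hs, by rw [hj, hs, hI]; simp⟩))

/-! ### Validity on P -/

namespace IsFeasible

variable {T L l : ℤ} {Clo Cup Vbar V : ℝ} {p : UCPoint T}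

lemma u_nonneg (h : IsFeasible T L l Clo Cup Vbar V p) {i : ℤ} (h2 : 2 ≤ i) (hT : i ≤ T) :
    0 ≤ p.u i := by
  rcases h.u_binary i (Finset.mem_Icc.2 ⟨h2, hT⟩) with h | h <;> simp [h]

lemma y_eq_zero_of_u (h : IsFeasible T L l Clo Cup Vbar V p) (hl : 1 ≤ l) (hlT : l ≤ T - 1)
    {i : ℤ} (h2 : 2 ≤ i) (hT : i ≤ T) (hu : p.u i = 1) : p.y (i - 1) = 0 := by
  have hy : ∀ k, 1 ≤ k → k ≤ T → p.y k = 0 ∨ p.y k = 1 := fun k h1 h2 =>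
    h.y_binary k (Finset.mem_Icc.2 ⟨h1, h2⟩)
  have key : ∀ k, l + 1 ≤ k → k ≤ T → k - l + 1 ≤ i → i ≤ k → p.y (k - l) = 0 := by
    intro k h1 h3 h4 h5
    have hm := h.min_down k (Finset.mem_Icc.2 ⟨h1, h3⟩)
    have hle := Finset.single_le_sum (f := fun i => p.u i) (fun j hj => by
      have := Finset.mem_Icc.1 hj
      exact h.u_nonneg (by omega) (by omega)) (Finset.mem_Icc.2 ⟨h4, h5⟩)
    rcases hy (k - l) (by omega) (by omega) with h0 | h0
    · exact h0
    · simp only [hu] at hle; linarith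
  rcases le_or_gt (i - 1) (T - l) with hc | hc
  · simpa using key (i - 1 + l) (by omega) (by omega) (by omega) (by omega)
  -- The window starting at i overruns the horizon. The constraint at T still gives y = 0 at T - l
  -- and leaves i as the only start in [T - l + 1, T], so the unit stays offline up to i - 1.
  · have hm := h.min_down T (Finset.mem_Icc.2 ⟨by omega, le_rfl⟩)
    have h0 := key T (by omega) le_rfl (by omega) hT
    have hind : ∀ k, T - l ≤ k → k ≤ i - 1 → p.y k = 0 := by
      intro k hk
      induction k, hk using Int.leInduction with
      | base => exact fun _ => h0
      | succ k hk ih =>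
        intro hki
        have hk0 := ih (by omega)
        have hs := h.start_up (k + 1) (Finset.mem_Icc.2 ⟨by omega, by omega⟩)
        have hle := Finset.add_le_sum (f := fun i => p.u i) (s := Finset.Icc (T - l + 1) T)
          (i := i) (j := k + 1) (fun j hj => by
            have := Finset.mem_Icc.1 hj
            exact h.u_nonneg (by omega) (by omega)) (Finset.mem_Icc.2 ⟨by omega, by omega⟩)
            (Finset.mem_Icc.2 ⟨by omega, by omega⟩) (by omega)
        have hn := h.u_nonneg (i := k + 1) (by omega) (by omega)
        rw [add_sub_cancel_right] at hs
        rcases hy (k + 1) (by omega) (by omega) with h1 | h1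
        · exact h1
        · simp only [hu] at hle; linarith
    exact hind _ (by omega) le_rfl

lemma y_eq_one_of_u (h : IsFeasible T L l Clo Cup Vbar V p) (hLT : L ≤ T - 1)
    {i k : ℤ} (h2 : 2 ≤ i) (hik : i ≤ k) (hk : k ≤ i + L - 1) (hkT : k ≤ T)
    (hu : p.u i = 1) : p.y k = 1 := by
  have hy : ∀ k, 1 ≤ k → k ≤ T → p.y k = 0 ∨ p.y k = 1 := fun k h1 h2 =>
    h.y_binary k (Finset.mem_Icc.2 ⟨h1, h2⟩)
  have key : ∀ k, L + 1 ≤ k → k ≤ T → k - L + 1 ≤ i → i ≤ k → p.y k = 1 := by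
    intro k h1 h3 h4 h5
    have hm := h.min_up k (Finset.mem_Icc.2 ⟨h1, h3⟩)
    have hle := Finset.single_le_sum (f := fun i => p.u i) (fun j hj => by
      have := Finset.mem_Icc.1 hj
      exact h.u_nonneg (by omega) (by omega)) (Finset.mem_Icc.2 ⟨h4, h5⟩)
    rcases hy k (by omega) (by omega) with h0 | h0
    · simp only [hu] at hle; linarith
    · exact h0
  rcases le_or_gt (L + 1) k with hc | hc
  · exact key k hc hkT (by omega) hik
  -- No minimum-up constraint exists at k ≤ L. The one at L + 1 gives y = 1 there and allows no
  -- start in [2, L + 1] other than i, so y = 1 propagates backwards to i.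
  · have hm := h.min_up (L + 1) (Finset.mem_Icc.2 ⟨by omega, by omega⟩)
    have h1 := key (L + 1) (by omega) (by omega) (by omega) (by omega)
    have hind : ∀ k, k ≤ L + 1 → i ≤ k → p.y k = 1 := by
      intro k hk
      induction k, hk using Int.leInductionDown with
      | base => exact fun _ => h1
      | pred k hk ih =>
        intro hki
        have hk0 := ih (by omega)
        have hs := h.start_up k (Finset.mem_Icc.2 ⟨by omega, by omega⟩)
        have hle := Finset.add_le_sum (f := fun i => p.u i)
          (s := Finset.Icc (L + 1 - L + 1) (L + 1)) (i := i) (j := k) (fun j hj => by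
            have := Finset.mem_Icc.1 hj
            exact h.u_nonneg (by omega) (by omega)) (Finset.mem_Icc.2 ⟨by omega, by omega⟩)
            (Finset.mem_Icc.2 ⟨by omega, by omega⟩) (by omega)
        have hn := h.u_nonneg (i := k) (by omega) (by omega)
        rcases hy (k - 1) (by omega) (by omega) with h1 | h1
        · simp only [hu] at hle; linarith
        · exact h1
    exact hind k (by omega) hik

lemma slack_nonpos (h : IsFeasible T L l Clo Cup Vbar V p) (hL : 1 ≤ L) (hl : 1 ≤ l)
    (hTLl : 2 ≤ T → L ≤ T - 1 ∧ l ≤ T - 1) {t : ℤ} (ht1 : 1 ≤ t)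
    (htT : t ≤ T) : slack T L Cup Vbar t p ≤ 0 := by
  have hup := h.upper_bound t (Finset.mem_Icc.2 ⟨ht1, htT⟩)
  have hyt := h.y_binary t (Finset.mem_Icc.2 ⟨ht1, htT⟩)
  -- Before a start the unit is offline with x ≤ 0, so ramp-up caps the output at `Vbar`.
  have hstart : 2 ≤ t → p.u t = 1 → p.y t = 1 ∧ p.x t ≤ Vbar := by
    intro h2 hu
    have hTl := hTLl (by omega)
    have h0 := h.y_eq_zero_of_u hl hTl.2 h2 htT hu
    have hr := h.ramp_up t (Finset.mem_Icc.2 ⟨h2, htT⟩)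
    have hb := h.upper_bound (t - 1) (Finset.mem_Icc.2 ⟨by omega, by omega⟩)
    rw [h0] at hr hb
    exact ⟨h.y_eq_one_of_u hTl.1 h2 le_rfl (by omega) htT hu, by linarith⟩
  simp only [slack, LinearMap.coe_mk, AddHom.coe_mk]
  rcases idx_cases hL ht1 htT (fun i => p.u i) with
    ⟨h1, h2, hs, hj⟩ | ⟨h1, h2, hs, hj⟩ | ⟨h1, h2, hs, hj⟩ | ⟨h1, h2, h3, hs, hj⟩
  · rw [hj, hs]; linarith
  · rw [hj, hs]
    rcases h.u_binary t (Finset.mem_Icc.2 ⟨by omega, htT⟩) with hu | hu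
    · rw [hu]; linarith
    · obtain ⟨hy1, hx⟩ := hstart (by omega) hu
      rw [hu, hy1]; linarith
  all_goals
    rw [hj, hs]
    have hTl := hTLl (by omega)
    have hs' := h.start_up (t + 1) (Finset.mem_Icc.2 ⟨by omega, by omega⟩)
    have hr := h.ramp_down (t + 1) (Finset.mem_Icc.2 ⟨by omega, by omega⟩)
    have hb := h.upper_bound (t + 1) (Finset.mem_Icc.2 ⟨by omega, by omega⟩)
    have hy' := h.y_binary (t + 1) (Finset.mem_Icc.2 ⟨by omega, by omega⟩)
    have hu' := h.u_binary (t + 1) (Finset.mem_Icc.2 ⟨by omega, by omega⟩)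
    have hz := h.y_eq_zero_of_u (i := t + 1) hl hTl.2 (by omega) (by omega)
    have ho : p.u (t + 1) = 1 → p.y (t + 1) = 1 :=
      h.y_eq_one_of_u hTl.1 (by omega) le_rfl (by omega) (by omega)
    rw [add_sub_cancel_right] at hs' hr hz
  · rcases hyt with hyt | hyt <;> rcases hy' with hy' | hy' <;> rcases hu' with hu' | hu' <;>
      simp [hyt, hy', hu'] at * <;> linarith
  · have hn : p.u t = 1 → p.y (t + 1) = 1 :=
      h.y_eq_one_of_u hTl.1 (by omega) (by omega) (by omega) (by omega)
    have hst := hstart h3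
    rcases h.u_binary t (Finset.mem_Icc.2 ⟨by omega, htT⟩) with hu | hu <;>
    rcases hyt with hyt | hyt <;> rcases hy' with hy' | hy' <;> rcases hu' with hu' | hu' <;>
      simp [hyt, hy', hu', hu] at * <;> linarith

end IsFeasible

/-! ### Interval schedules on the face -/

/-- As V = `Cup - Clo`, ramping is unrestricted while online; it matters only at a genuine start (a
≥ 2) or stop (b < T). -/
lemma isFeasible_interval {T L l a b : ℤ} {Clo Cup Vbar V : ℝ} (hl : 1 ≤ l)
    (hClo : 0 ≤ Clo) (hVlo : Clo < Vbar) (hVC : Vbar < Cup) (hV : V = Cup - Clo)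
    (ha : 1 ≤ a) (hb : b ≤ T) (hab : a = 1 ∨ b = T ∨ a + L ≤ b + 1) {f : ℤ → ℝ}
    (hf : ∀ i, Clo ≤ f i ∧ f i ≤ Cup) (hfa : 2 ≤ a → a ≤ b → f a ≤ Vbar)
    (hfb : b < T → a ≤ b → f b ≤ Vbar) (hL : 1 ≤ L) :
    interval T a b f ∈ feasibleSet T L l Clo Cup Vbar V where
  x_nonneg t ht := by
    obtain ⟨h1, h2⟩ := Finset.mem_Icc.1 ht
    rw [interval_x f h1 h2]
    split_ifs
    · exact hClo.trans (hf t).1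
    · exact le_rfl
  y_binary t ht := by
    obtain ⟨h1, h2⟩ := Finset.mem_Icc.1 ht
    rw [interval_y f h1 h2]
    split_ifs <;> simp
  u_binary t ht := by
    obtain ⟨h1, h2⟩ := Finset.mem_Icc.1 ht
    rw [interval_u f h1 h2]
    split_ifs <;> simp
  min_up t ht := by
    obtain ⟨h1, h2⟩ := Finset.mem_Icc.1 ht
    rw [sum_interval_u f (by omega) h2, interval_y f (by omega) h2]
    split_ifs <;> first | omega | norm_num
  min_down t ht := by
    obtain ⟨h1, h2⟩ := Finset.mem_Icc.1 ht
    rw [sum_interval_u f (by omega) h2, interval_y f (by omega) (by omega)]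
    split_ifs <;> first | omega | norm_num
  start_up t ht := by
    obtain ⟨h1, h2⟩ := Finset.mem_Icc.1 ht
    rw [interval_u f h1 h2, interval_y f (by omega) h2, interval_y f (by omega) (by omega)]
    split_ifs <;> first | omega | norm_num
  lower_bound t ht := by
    obtain ⟨h1, h2⟩ := Finset.mem_Icc.1 ht
    rw [interval_x f h1 h2, interval_y f h1 h2]
    split_ifs
    · linarith [(hf t).1]
    · simp
  upper_bound t ht := by
    obtain ⟨h1, h2⟩ := Finset.mem_Icc.1 ht
    rw [interval_x f h1 h2, interval_y f h1 h2]
    split_ifs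
    · linarith [(hf t).2]
    · simp
  ramp_up t ht := by
    obtain ⟨h1, h2⟩ := Finset.mem_Icc.1 ht
    rw [interval_x f (by omega) h2, interval_x f (by omega) (by omega),
      interval_y f (by omega) (by omega)]
    have := hf t
    have := hf (t - 1)
    split_ifs
    · linarith
    · obtain rfl : t = a := by omega
      linarith [hfa h1 (by omega)]
    · linarith
    · linarith
  ramp_down t ht := by
    obtain ⟨h1, h2⟩ := Finset.mem_Icc.1 ht
    rw [interval_x f (by omega) h2, interval_x f (by omega) (by omega),
      interval_y f (by omega) h2]
    have := hf t
    have := hf (t - 1)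
    split_ifs
    · linarith
    · obtain rfl : t - 1 = b := by omega
      linarith [hfb (by omega) (by omega)]
    · linarith
    · linarith

/-- `hta` excludes the one failure: with L = 1 the sum omits u_t, so starting at t and running on
makes the right side `Cup` while x_t = `Vbar`. -/
lemma slack_interval_eq_zero {T L t a b : ℤ} {Cup Vbar : ℝ} {f : ℤ → ℝ} (hL : 1 ≤ L)
    (ht1 : 1 ≤ t) (htT : t ≤ T) (ha : 1 ≤ a) (hb : b ≤ T)
    (hab : a = 1 ∨ b = T ∨ a + L ≤ b + 1)
    (hta : ¬ (L = 1 ∧ 2 ≤ a ∧ a = t ∧ t < b))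
    (hft : f t = if (t = a ∧ 2 ≤ a) ∨ (t = b ∧ b < T) then Vbar else Cup) :
    slack T L Cup Vbar t (interval T a b f) = 0 := by
  simp only [slack, LinearMap.coe_mk, AddHom.coe_mk]
  rcases idx_cases hL ht1 htT (fun i => u (interval T a b f) i) with
    ⟨h1, h2, hs, hj⟩ | ⟨h1, h2, hs, hj⟩ | ⟨h1, h2, hs, hj⟩ | ⟨h1, h2, h3, hs, hj⟩
  · rw [hj, hs, interval_x f ht1 htT, interval_y f ht1 htT, hft]
    split_ifs <;> first | omega | ring
  · rw [hj, hs, interval_x f ht1 htT, interval_y f ht1 htT,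
      interval_u f (by omega) htT, hft]
    split_ifs <;> first | omega | ring
  · rw [hj, hs, interval_x f ht1 htT, interval_y f ht1 htT, interval_y f (by omega) (by omega),
      interval_u f (by omega) (by omega), hft]
    split_ifs <;> first | omega | ring
  · rw [hj, hs, interval_x f ht1 htT, interval_y f ht1 htT, interval_y f (by omega) (by omega),
      interval_u f (by omega) (by omega), interval_u f (by omega) (by omega), hft]
    split_ifs <;> first | omega | ring

theorem mainTheorem4 (T L l : ℤ) (Clo Cup Vbar V : ℝ)
    (hT : 1 ≤ T) (hL : 1 ≤ L) (hl : 1 ≤ l)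
    (hTLl : 2 ≤ T → L ≤ T - 1 ∧ l ≤ T - 1)
    (hClo : 0 ≤ Clo) (hVbar_lower : Clo < Vbar) (hVbar_upper : Vbar < Clo + V)
    (hV : V = Cup - Clo) (t : ℤ) (ht : t ∈ Finset.Icc 1 T) :
    IsValidIneq (convexHull ℝ (feasibleSet T L l Clo Cup Vbar V))
      (fun p => p.x t)
      (fun p => Vbar * p.y t + (Cup - Vbar) *
        (p.y (idxS T t) - ∑ i ∈ Finset.Icc 0 (idxJ T L t), p.u (idxS T t - i))) ∧
    IsFacetDefining (convexHull ℝ (feasibleSet T L l Clo Cup Vbar V))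
      (fun p => p.x t)
      (fun p => Vbar * p.y t + (Cup - Vbar) *
        (p.y (idxS T t) - ∑ i ∈ Finset.Icc 0 (idxJ T L t), p.u (idxS T t - i))) := by
  obtain ⟨ht1, htT⟩ := Finset.mem_Icc.1 ht
  have hVC : Vbar < Cup := by linarith
  set K := convexHull ℝ (feasibleSet T L l Clo Cup Vbar V) with hK
  have hPK : feasibleSet T L l Clo Cup Vbar V ⊆ K := subset_convexHull ℝ _
  have hvalid : IsValidIneq K (fun p => p.x t)
      (fun p => Vbar * p.y t + (Cup - Vbar) *
        (p.y (idxS T t) - ∑ i ∈ Finset.Icc 0 (idxJ T L t), p.u (idxS T t - i))) := by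
    intro p hp
    have hsub : K ⊆ {p | slack T L Cup Vbar t p ≤ 0} :=
      convexHull_min (fun q hq => IsFeasible.slack_nonpos hq hL hl hTLl ht1 htT)
        (convex_halfSpace_le (slack T L Cup Vbar t).isLinear 0)
    exact sub_nonpos.1 (hsub hp)
  refine ⟨hvalid, hvalid, ?_⟩
  set F := {p ∈ K | p.x t = Vbar * p.y t + (Cup - Vbar) *
        (p.y (idxS T t) - ∑ i ∈ Finset.Icc 0 (idxJ T L t), p.u (idxS T t - i))} with hF
  have hFslack : ∀ p ∈ F, slack T L Cup Vbar t p = 0 := fun p hp => sub_eq_zero.2 hp.2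
  have hmem : ∀ (a b : ℤ) (f : ℤ → ℝ), 1 ≤ a → b ≤ T →
      (a = 1 ∨ b = T ∨ a + L ≤ b + 1) → ¬ (L = 1 ∧ 2 ≤ a ∧ a = t ∧ t < b) →
      (∀ i, Clo ≤ f i ∧ f i ≤ Cup) → (2 ≤ a → a ≤ b → f a ≤ Vbar) →
      (b < T → a ≤ b → f b ≤ Vbar) →
      (f t = if (t = a ∧ 2 ≤ a) ∨ (t = b ∧ b < T) then Vbar else Cup) →
      interval T a b f ∈ F := fun a b f h1 h2 h3 h4 h5 h6 h7 h8 =>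
    ⟨hPK (isFeasible_interval hl hClo hVbar_lower hVC hV h1 h2 h3 h5 h6 h7 hL),
      sub_eq_zero.1 (slack_interval_eq_zero hL ht1 htT h1 h2 h3 h4 h8)⟩
  have hmem' : ∀ a b : ℤ, 1 ≤ a → b ≤ T →
      (a = 1 ∨ b = T ∨ a + L ≤ b + 1) → ¬ (L = 1 ∧ 2 ≤ a ∧ a = t ∧ t < b) →
      ∃ f, interval T a b f ∈ F := fun a b h1 h2 h3 h4 => by
    -- Equality dictates the value at t; `Clo` elsewhere is below `Vbar` and so meets the start and
    -- stop limits.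
    refine ⟨fun i => if i = t then
      (if (t = a ∧ 2 ≤ a) ∨ (t = b ∧ b < T) then Vbar else Cup) else Clo,
      hmem a b _ h1 h2 h3 h4 (fun i => ?_) (fun h5 h6 => ?_) (fun h5 h6 => ?_) (by simp)⟩
    · split_ifs <;> constructor <;> linarith
    · split_ifs <;> first | linarith | omega
    · split_ifs <;> first | linarith | omega
  have h0 : (0 : UCPoint T) ∈ F := by
    -- The empty interval [T + 1, T]: its start lies past the horizon, so u = 0 as well.
    obtain ⟨f, hf⟩ := hmem' (T + 1) T (by omega) le_rfl (by omega) (by omega)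
    convert hf
    refine Prod.ext (funext fun i => ?_) (Prod.ext (funext fun i => ?_) (funext fun i => ?_)) <;>
      have := Finset.mem_Icc.1 i.2
    · simp [interval]
    · simp [interval]
    · simp [interval, show i.1 ≠ T + 1 by omega]
  have hFS : ∀ p ∈ F, p ∈ vectorSpan ℝ F := fun p hp => by
    simpa using vsub_mem_vectorSpan ℝ hp h0
  -- Needed for F when r ≠ t, and for K when r = t, where lowering the output leaves the face.
  have hdir : ∀ (S : Set (UCPoint T)) (r : ℤ) (hr : r ∈ Finset.Icc 1 T),
      interval T 1 T (fun _ => Cup) ∈ S →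
      interval T 1 T (Function.update (fun _ => Cup) r Clo) ∈ S →
      unitX ⟨r, hr⟩ ∈ vectorSpan ℝ S := by
    intro S r hr h1 h2
    have h3 := vsub_mem_vectorSpan ℝ h1 h2
    rw [vsub_eq_sub, interval_sub_interval hr _ _ (fun i hi => by simp [hi])] at h3
    refine (Submodule.smul_mem_iff _ ?_).1 h3
    simp only [Function.update_self]
    linarith
  have hCup : interval T 1 T (fun _ => Cup) ∈ F :=
    hmem 1 T _ le_rfl le_rfl (by omega) (by omega) (fun i => by constructor <;> linarith)
      (by omega) (by omega) (by rw [if_neg (by omega)])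
  have hupd : ∀ r i : ℤ, Clo ≤ Function.update (fun _ => Cup) r Clo i ∧
      Function.update (fun _ => Cup) r Clo i ≤ Cup := fun r i => by
    by_cases h : i = r
    · subst h; simp; linarith
    · simp [h]; linarith
  refine ⟨⟨0, h0⟩, affineDim_add_one_of_sup_span_eq_top (slack T L Cup Vbar t)
    (unitX ⟨t, ht⟩) hFslack ?_ (fun p hp => hp.1) (hdir K t ht hCup.1 (hPK ?_)) ?_⟩
  · have h1 : x (unitX (T := T) ⟨t, ht⟩) t = 1 := by simp [x, valAt, unitX, ht1, htT]
    have h2 : ∀ i, y (unitX (T := T) ⟨t, ht⟩) i = 0 := fun i => by simp [y, valAt, unitX]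
    have h3 : ∀ i, u (unitX (T := T) ⟨t, ht⟩) i = 0 := fun i => by simp [u, valAt, unitX]
    simp [slack, h1, h2, h3]
  · exact isFeasible_interval hl hClo hVbar_lower hVC hV le_rfl le_rfl (by omega) (hupd t)
      (by omega) (by omega) hL
  · refine Submodule.eq_top_of_interval_mem _ (fun r => ?_) (fun b h1 h2 => ?_)
      (fun a h1 h2 => ?_)
    · by_cases hr : r = ⟨t, ht⟩
      · subst hr
        exact Submodule.mem_sup_right (Submodule.mem_span_singleton_self _)
      · have hrt : t ≠ r.1 := fun h => hr (Subtype.ext h.symm)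
        refine Submodule.mem_sup_left (hdir F r.1 r.2 hCup
          (hmem 1 T _ le_rfl le_rfl (by omega) (by omega) (hupd r) (by omega) (by omega) ?_))
        rw [if_neg (by omega)]
        simp [hrt]
    · obtain ⟨f, hf⟩ := hmem' 1 b le_rfl h2 (by omega) (by omega)
      exact ⟨f, Submodule.mem_sup_left (hFS _ hf)⟩
    -- Here [t, T] may be off the face, but L = 1 permits the one-period schedule [t, t].
    · by_cases hc : L = 1 ∧ a = t
      · obtain ⟨f, hf⟩ := hmem' a a (by omega) h2 (by omega) (by omega)
        exact ⟨a, f, Submodule.mem_sup_left (hFS _ hf)⟩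
      · obtain ⟨f, hf⟩ := hmem' a T (by omega) le_rfl (by omega) (by omega)
        exact ⟨T, f, Submodule.mem_sup_left (hFS _ hf)⟩
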